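/- Let $G=A\ast_C B$ be an amalgamated free product, with $A$, $B$ and $C\leqslant A\cap B$ regarded as subgroups of $G$, and let $N\lhd A$ be a normal subgroup of $A$ with $N\cap C=\{1\}$. Let $\langle\!\langle N\rangle\!\rangle$ be the normal closure of $N$ in $G$, and put $Q=G/\langle\!\langle N\rangle\!\rangle$ and $R=A/N$. Then: (1) $(G,A,N)$ has the Cohen–Lyndon property: there is a left transversal $T$ of the subgroup $A\langle\!\langle N\rangle\!\rangle$ in $G$ such that $\langle\!\langle N\rangle\!\rangle$ is the free product of its subgroups $tNt^{-1}$, $t\in T$. (2) The natural homomorphism $R\to Q$ is injective, so that $\mathbb{Z}R$ is identified with a subring of $\mathbb{Z}Q$, and there is an isomorphism of $\mathbb{Z}Q$-modules $$Rel(G,\langle\!\langle N\rangle\!\rangle)\cong Ind^Q_R\,Rel(A,N)=\mathbb{Z}Q\otimes_{\mathbb{Z}R}Rel(A,N).$$ Here, for a normal subgroup $M$ of a group $H$, the relative relation module $Rel(H,M)$ is the abelianization $M/[M,M]$ with the $\mathbb{Z}[H/M]$-module structure induced by the conjugation action of $H$ on $M$. -/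

import Mathlib

open scoped TensorProduct Pointwise

/-- The pair of subgroups `A`, `B` as a family indexed by `Bool` (`false ↦ A`, `true ↦ B`). -/
def pairFamily {G : Type*} [Group G] (A B : Subgroup G) : Bool → Subgroup G
  | false => A
  | true => B

theorem le_pairFamily {G : Type*} [Group G] {A B C : Subgroup G} (hA : C ≤ A) (hB : C ≤ B) :
    ∀ i : Bool, C ≤ pairFamily A B i
  | false => hA
  | true => hB

/-- The canonical homomorphism `A *_C B → G` from the abstract amalgamated product (pushout) of
two subgroups `A`, `B` of `G` over a common subgroup `C`, induced by the inclusions into `G`. -/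
def amalgamHom {G : Type*} [Group G] (A B C : Subgroup G) (hA : C ≤ A) (hB : C ≤ B) :
    Monoid.PushoutI (fun i : Bool => Subgroup.inclusion (le_pairFamily hA hB i)) →* G :=
  Monoid.PushoutI.lift (fun i => (pairFamily A B i).subtype) C.subtype (fun _ => rfl)

/-- `G = A *_C B`: the group `G` is the free product of its subgroups `A` and `B` with amalgamated
subgroup `C ≤ A ⊓ B`. -/
structure IsAmalgamatedProduct {G : Type*} [Group G] (A B C : Subgroup G) : Prop where
  le_left : C ≤ A
  le_right : C ≤ B
  bijective : Function.Bijective (amalgamHom A B C le_left le_right)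

/-- The subgroup `K` of `G` is the (internal) free product of the family `S` of subgroups. -/
def IsInternalFreeProduct {G : Type*} [Group G] {ι : Type*} (K : Subgroup G)
    (S : ι → Subgroup G) : Prop :=
  Function.Injective (Monoid.CoprodI.lift fun i => (S i).subtype) ∧
    (Monoid.CoprodI.lift fun i => (S i).subtype).range = K

/-- `⟪N⟫`: the normal closure in `G` of a subgroup `N` of a subgroup `H` of `G`. -/
abbrev normalCl {G : Type*} [Group G] {H : Subgroup G} (N : Subgroup H) : Subgroup G :=
  Subgroup.normalClosure (N.map H.subtype : Set G)

/-- The Cohen–Lyndon property of `(G, H, N)`: for some left transversal `T` of `H⟪N⟫` in `G`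
(every element of `G` is uniquely `t * k` with `t ∈ T`, `k ∈ H⟪N⟫`), the group `⟪N⟫` is the free
product of the subgroups `t N t⁻¹`, `t ∈ T`. -/
def CohenLyndonProperty {G : Type*} [Group G] (H : Subgroup G) (N : Subgroup H) [N.Normal] :
    Prop :=
  ∃ T : Set G, Subgroup.IsComplement T (H ⊔ normalCl N : Subgroup G) ∧
    IsInternalFreeProduct (normalCl N)
      (fun t : T => (N.map H.subtype).map (MulAut.conj (t : G)).toMonoidHom)

/-- The conjugation action of `H` on the abelianization of a normal subgroup `N`. -/
def relRepAux {H : Type*} [Group H] (N : Subgroup H) [N.Normal] :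
    Representation ℤ H (Additive (Abelianization N)) where
  toFun h := (MonoidHom.toAdditive
    (Abelianization.map (MulAut.conjNormal (H := N) h).toMonoidHom)).toIntLinearMap
  map_one' := by
    ext x
    induction x using Additive.rec with | ofMul x => ?_
    obtain ⟨n, rfl⟩ := QuotientGroup.mk_surjective x
    change Additive.ofMul (Abelianization.of (MulAut.conjNormal 1 n)) =
      Additive.ofMul (Abelianization.of n)
    rw [map_one]
    rfl
  map_mul' g h := by
    ext x
    induction x using Additive.rec with | ofMul x => ?_
    obtain ⟨n, rfl⟩ := QuotientGroup.mk_surjective x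
    change Additive.ofMul (Abelianization.of (MulAut.conjNormal (g * h) n)) =
      Additive.ofMul (Abelianization.of (MulAut.conjNormal g (MulAut.conjNormal h n)))
    rw [map_mul]
    rfl

/-- The induced action of `R = H ⧸ N` on the abelianization of `N`:
the class of `h` sends the class of `n` to the class of `h n h⁻¹`. -/
def relRep {H : Type*} [Group H] (N : Subgroup H) [N.Normal] :
    Representation ℤ (H ⧸ N) (Additive (Abelianization N)) :=
  QuotientGroup.lift N (relRepAux N) (by
    intro m hm
    ext x
    induction x using Additive.rec with | ofMul x => ?_
    obtain ⟨n, rfl⟩ := QuotientGroup.mk_surjective x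
    change Additive.ofMul (Abelianization.of (MulAut.conjNormal m n)) =
      Additive.ofMul (Abelianization.of n)
    congr 1
    have h : MulAut.conjNormal m n = (⟨m, hm⟩ : N) * n * (⟨m, hm⟩ : N)⁻¹ := by
      ext
      simp
    rw [h, map_mul, map_mul, map_inv, mul_comm (Abelianization.of _), mul_inv_cancel_right])

/-- `Rel(H, N)`: the relative relation module of `1 → N → H → H ⧸ N → 1`, a module over the
integral group ring `ℤ[H ⧸ N]`. -/
abbrev RelModule {H : Type*} [Group H] (N : Subgroup H) [N.Normal] : Type _ :=
  (relRep N).asModule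

/-- The submodule of `O ⊗[ℤ] M` generated by the elements `(x * f d) ⊗ m - x ⊗ (d • m)`. -/
def balancedRelations {D O : Type*} [Ring D] [Ring O] (f : D →+* O) (M : Type*)
    [AddCommGroup M] [Module D M] : Submodule O (O ⊗[ℤ] M) :=
  Submodule.span O {z | ∃ (x : O) (d : D) (m : M), z = (x * f d) ⊗ₜ[ℤ] m - x ⊗ₜ[ℤ] (d • m)}

/-- The induced module `O ⊗_D M` along a homomorphism `f : D → O` of not necessarily commutative
rings, as a left `O`-module. -/
abbrev InducedModule {D O : Type*} [Ring D] [Ring O] (f : D →+* O) (M : Type*)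
    [AddCommGroup M] [Module D M] : Type _ :=
  (O ⊗[ℤ] M) ⧸ balancedRelations f M

/-- The natural homomorphism `H ⧸ N → G ⧸ ⟪N⟫`. -/
def quotientHom {G : Type*} [Group G] {H : Subgroup G} (N : Subgroup H) [N.Normal] :
    H ⧸ N →* G ⧸ normalCl N :=
  QuotientGroup.map N (normalCl N) H.subtype
    (fun _ hn => Subgroup.subset_normalClosure (Subgroup.mem_map_of_mem _ hn))

/-- The ring homomorphism `ℤ[H ⧸ N] → ℤ[G ⧸ ⟪N⟫]` of integral group rings induced by the natural
homomorphism of groups. -/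
noncomputable def groupRingHom {G : Type*} [Group G] {H : Subgroup G} (N : Subgroup H)
    [N.Normal] : MonoidAlgebra ℤ (H ⧸ N) →+* MonoidAlgebra ℤ (G ⧸ normalCl N) :=
  MonoidAlgebra.mapDomainRingHom ℤ (quotientHom N)

/-! Write `Q = G ⧸ ⟪N⟫`. Since `C` meets `N` trivially, `A ⧸ N` embeds in its pushout with `B` over
`C`, and `G` maps to that pushout killing `N`; hence `A ∩ ⟪N⟫ = N` and `R → Q` is injective.

The Cohen–Lyndon property comes from the action of `G` on `Q`. Cocycles `γ : G × Q → F` can be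
prescribed on `A` and `B` when they agree on `C` (`exists_cocycle`). Free actions give a map `s : Q
→ A` that is equivariant for `C`, and for `A` modulo `N`; from it a cocycle builds a section `σ` of
`G → Q`. The elements `u q = (σ q)⁻¹ * s q` are constant on `A`-orbits and form the transversal. A
second cocycle, with values in the abstract free product of the conjugates, lifts `(σ (g q))⁻¹ * g *
σ q`. At `q = 1` it inverts the natural map from the free product to `⟪N⟫`.

Abelianizing the free product gives one copy of `Rel(A, N)` for each coset of `R` in `Q`, which is
the induced module. -/

/-! ### Homomorphisms and cocycles on an amalgamated product. -/

theorem amalgamHom_of {G : Type*} [Group G] {A B C : Subgroup G} (hA : C ≤ A) (hB : C ≤ B)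
    (i : Bool) (x : pairFamily A B i) :
    amalgamHom A B C hA hB (Monoid.PushoutI.of (G := fun i => pairFamily A B i)
      (φ := fun i => Subgroup.inclusion (le_pairFamily hA hB i)) i x) = x :=
  Monoid.PushoutI.lift_of (G := fun i => pairFamily A B i) _ _ _ x

theorem amalgamHom_base {G : Type*} [Group G] {A B C : Subgroup G} (hA : C ≤ A) (hB : C ≤ B)
    (c : C) :
    amalgamHom A B C hA hB (Monoid.PushoutI.base (G := fun i => pairFamily A B i)
      (fun i => Subgroup.inclusion (le_pairFamily hA hB i)) c) = c :=
  Monoid.PushoutI.lift_base (G := fun i => pairFamily A B i) _ _ _ c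

/-- Homomorphisms on the two factors which agree on the amalgamated subgroup extend to the
amalgamated product. -/
theorem IsAmalgamatedProduct.exists_hom {G H : Type*} [Group G] [Group H] {A B C : Subgroup G}
    (hG : IsAmalgamatedProduct A B C) (f : A →* H) (g : B →* H)
    (h : ∀ c (hc : c ∈ C), f ⟨c, hG.le_left hc⟩ = g ⟨c, hG.le_right hc⟩) :
    ∃ φ : G →* H, (∀ a : A, φ a = f a) ∧ ∀ b : B, φ b = g b := by
  let F : ∀ i : Bool, pairFamily A B i →* H := fun i => match i with
    | false => f
    | true => g
  let L : Monoid.PushoutI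
      (fun i : Bool => Subgroup.inclusion (le_pairFamily hG.le_left hG.le_right i)) →* H :=
    Monoid.PushoutI.lift F (f.comp (Subgroup.inclusion hG.le_left)) (by
      rintro (_ | _)
      · rfl
      · ext c
        exact (h c c.2).symm)
  let e := MulEquiv.ofBijective _ hG.bijective
  have he : ∀ i (x : pairFamily A B i), e.symm (x : G) =
      Monoid.PushoutI.of (G := fun i => pairFamily A B i) i x := by
    intro i x
    rw [MulEquiv.symm_apply_eq]
    exact (amalgamHom_of hG.le_left hG.le_right i x).symm
  refine ⟨L.comp e.symm.toMonoidHom, fun a => ?_, fun b => ?_⟩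
  · change L (e.symm _) = _
    rw [he false a]
    exact Monoid.PushoutI.lift_of (G := fun i => pairFamily A B i) F _ _ _
  · change L (e.symm _) = _
    rw [he true b]
    exact Monoid.PushoutI.lift_of (G := fun i => pairFamily A B i) F _ _ _

/-- An amalgamated product is generated by its factors. -/
theorem IsAmalgamatedProduct.sup_eq_top {G : Type*} [Group G] {A B C : Subgroup G}
    (hG : IsAmalgamatedProduct A B C) : A ⊔ B = ⊤ := by
  rw [eq_top_iff]
  intro g _
  obtain ⟨x, rfl⟩ := hG.bijective.2 g
  induction x using Monoid.PushoutI.induction_on with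
  | of i x =>
    rw [amalgamHom_of]
    cases i with
    | false => exact Subgroup.mem_sup_left x.2
    | true => exact Subgroup.mem_sup_right x.2
  | base c =>
    rw [amalgamHom_base]
    exact Subgroup.mem_sup_left (hG.le_left c.2)
  | mul x y hx hy =>
    rw [map_mul]
    exact mul_mem (hx trivial) (hy trivial)

/-- Induction on the elements of an amalgamated product, multiplying on the left by elements of
the factors. -/
theorem IsAmalgamatedProduct.induction_left {G : Type*} [Group G] {A B C : Subgroup G}
    (hG : IsAmalgamatedProduct A B C) {P : G → Prop} (one : P 1)
    (left : ∀ (a : A) g, P g → P (a * g)) (right : ∀ (b : B) g, P g → P (b * g)) (g : G) : P g := by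
  have hg : g ∈ Subgroup.closure ((A : Set G) ∪ B) := by
    rw [← Subgroup.sup_eq_closure, hG.sup_eq_top]
    trivial
  induction hg using Subgroup.closure_induction_left with
  | one => exact one
  | mul_left x hx y _ hy => exact hx.elim (fun h => left ⟨x, h⟩ y hy) fun h => right ⟨x, h⟩ y hy
  | inv_mul_cancel x hx y _ hy =>
    exact hx.elim (fun h => left (⟨x, h⟩⁻¹) y hy) fun h => right (⟨x, h⟩⁻¹) y hy

/-- Cocycles on the two factors which agree on the amalgamated subgroup extend to the
amalgamated product. -/
theorem IsAmalgamatedProduct.exists_cocycle {G Q F : Type*} [Group G] [Group Q] [Group F]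
    {A B C : Subgroup G} (hG : IsAmalgamatedProduct A B C) (π : G →* Q)
    (α : A → Q → F) (hα : ∀ a a' q, α (a * a') q = α a (π a' * q) * α a' q)
    (β : B → Q → F) (hβ : ∀ b b' q, β (b * b') q = β b (π b' * q) * β b' q)
    (h : ∀ c (hc : c ∈ C) q, α ⟨c, hG.le_left hc⟩ q = β ⟨c, hG.le_right hc⟩ q) :
    ∃ γ : G → Q → F, (∀ g g' q, γ (g * g') q = γ g (π g' * q) * γ g' q) ∧
      (∀ (a : A) q, γ a q = α a q) ∧ ∀ (b : B) q, γ b q = β b q := by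
  -- A cocycle is the same as a homomorphism to the wreath product lying over `π`, so the universal
  -- property for homomorphisms applies.
  let f : A →* RegularWreathProduct F Q := MonoidHom.mk'
    (fun a => ⟨fun x => α a ((π a)⁻¹ * x), π a⟩) (by
      intro a a'
      ext x
      · simp [hα, mul_assoc]
      · simp)
  let g : B →* RegularWreathProduct F Q := MonoidHom.mk'
    (fun b => ⟨fun x => β b ((π b)⁻¹ * x), π b⟩) (by
      intro b b'
      ext x
      · simp [hβ, mul_assoc]
      · simp)
  obtain ⟨φ, hφA, hφB⟩ := hG.exists_hom f g (by
    intro c hc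
    ext x
    · exact h c hc _
    · rfl)
  have hr : ∀ x, (φ x).right = π x := by
    intro x
    induction x using hG.induction_left with
    | one => simp
    | left a x hx => simp [hφA, hx, f]
    | right b x hx => simp [hφB, hx, g]
  refine ⟨fun x q => (φ x).left (π x * q), fun x y q => ?_, fun a q => ?_, fun b q => ?_⟩
  · simp [hr, mul_assoc]
  · simp [hφA, f]
  · simp [hφB, g]

theorem cocycle_one {G Q F : Type*} [Group G] [Group Q] [Group F] {π : G →* Q} {γ : G → Q → F}
    (hγ : ∀ g g' q, γ (g * g') q = γ g (π g' * q) * γ g' q) (q : Q) : γ 1 q = 1 := by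
  simpa using hγ 1 1 q

theorem cocycle_inv {G Q F : Type*} [Group G] [Group Q] [Group F] {π : G →* Q} {γ : G → Q → F}
    (hγ : ∀ g g' q, γ (g * g') q = γ g (π g' * q) * γ g' q) (g : G) (q : Q) :
    γ g⁻¹ q = (γ g (π g⁻¹ * q))⁻¹ := by
  have h := hγ g g⁻¹ q
  rw [mul_inv_cancel, cocycle_one hγ] at h
  exact eq_inv_of_mul_eq_one_right h.symm

/-! ### The embedding of `A ⧸ N` in the quotient. -/

/-- The groups of the diagram obtained from `A` and `B` by killing a normal subgroup of `A`. -/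
def quotientPair {G : Type*} [Group G] {A : Subgroup G} (N : Subgroup A) (B : Subgroup G) :
    Bool → Type _
  | false => A ⧸ N
  | true => B

instance quotientPair.group {G : Type*} [Group G] {A : Subgroup G} (N : Subgroup A) [N.Normal]
    (B : Subgroup G) : ∀ i, Group (quotientPair N B i)
  | false => inferInstanceAs (Group (A ⧸ N))
  | true => inferInstanceAs (Group B)

/-- The homomorphisms of the amalgamated subgroup to the groups of `quotientPair`. -/
def quotientPairHom {G : Type*} [Group G] {A B C : Subgroup G} (hA : C ≤ A) (hB : C ≤ B)
    (N : Subgroup A) [N.Normal] : ∀ i, C →* quotientPair N B i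
  | false => (QuotientGroup.mk' N).comp (Subgroup.inclusion hA)
  | true => Subgroup.inclusion hB

/-- If `N ⊓ C = ⊥`, then `A ⊓ ⟪N⟫ = N`. -/
theorem IsAmalgamatedProduct.mem_of_mem_normalCl {G : Type*} [Group G] {A B C : Subgroup G}
    (hG : IsAmalgamatedProduct A B C) {N : Subgroup A} [N.Normal]
    (hNC : N.map A.subtype ⊓ C = ⊥) {a : A} (ha : (a : G) ∈ normalCl N) : a ∈ N := by
  let ψ := quotientPairHom hG.le_left hG.le_right N
  have hψ : ∀ i, Function.Injective (ψ i) := by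
    rintro (_ | _)
    -- `N ∩ C = 1` keeps `C → A ⧸ N` injective, so the factors embed in the pushout.
    · refine (injective_iff_map_eq_one _).2 fun c hc => ?_
      have hc' : Subgroup.inclusion hG.le_left c ∈ N := (QuotientGroup.eq_one_iff _).1 hc
      have : (c : G) ∈ N.map A.subtype ⊓ C := ⟨⟨_, hc', rfl⟩, c.2⟩
      rw [hNC, Subgroup.mem_bot] at this
      exact Subtype.ext this
    · exact Subgroup.inclusion_injective hG.le_right
  let f : A →* Monoid.PushoutI ψ :=
    (Monoid.PushoutI.of (φ := ψ) false).comp (QuotientGroup.mk' N)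
  let g : B →* Monoid.PushoutI ψ := Monoid.PushoutI.of (φ := ψ) true
  obtain ⟨φ, hφA, -⟩ := hG.exists_hom f g (by
    intro c hc
    exact (Monoid.PushoutI.of_apply_eq_base ψ false ⟨c, hc⟩).trans
      (Monoid.PushoutI.of_apply_eq_base ψ true ⟨c, hc⟩).symm)
  have hker : normalCl N ≤ φ.ker := by
    refine Subgroup.normalClosure_le_normal ?_
    rintro _ ⟨n, hn, rfl⟩
    have : (QuotientGroup.mk' N) n = 1 := (QuotientGroup.eq_one_iff n).2 hn
    change φ n = 1
    rw [hφA]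
    change Monoid.PushoutI.of (φ := ψ) false ((QuotientGroup.mk' N) n) = 1
    rw [this]
    exact map_one (Monoid.PushoutI.of (φ := ψ) false)
  have h1 : φ a = 1 := hker ha
  rw [hφA] at h1
  have h2 : Monoid.PushoutI.of (φ := ψ) false ((QuotientGroup.mk' N) a) =
      Monoid.PushoutI.of (φ := ψ) false 1 := h1.trans (map_one _).symm
  exact (QuotientGroup.eq_one_iff a).1 (Monoid.PushoutI.of_injective hψ false h2)

theorem IsAmalgamatedProduct.quotientHom_injective {G : Type*} [Group G] {A B C : Subgroup G}
    (hG : IsAmalgamatedProduct A B C) {N : Subgroup A} [N.Normal]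
    (hNC : N.map A.subtype ⊓ C = ⊥) : Function.Injective (quotientHom N) := by
  refine (injective_iff_map_eq_one _).2 fun x hx => ?_
  obtain ⟨a, rfl⟩ := QuotientGroup.mk_surjective x
  exact (QuotientGroup.eq_one_iff a).2
    (hG.mem_of_mem_normalCl hNC ((QuotientGroup.eq_one_iff (a : G)).1 hx))

/-! ### Equivariant maps and the section. -/

/-- A free action admits an equivariant choice function for an invariant relation. -/
theorem exists_equivariant_choice {Γ X Y : Type*} [Group Γ] [MulAction Γ X] [MulAction Γ Y]
    (hfree : ∀ (g : Γ) (x : X), g • x = x → g = 1) (P : X → Y → Prop)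
    (hP : ∀ (g : Γ) x y, P x y → P (g • x) (g • y)) (hex : ∀ x, ∃ y, P x y) :
    ∃ f : X → Y, (∀ (g : Γ) x, f (g • x) = g • f x) ∧ ∀ x, P x (f x) := by
  classical
  let o : X → X := fun x => (Quotient.mk (MulAction.orbitRel Γ X) x).out
  have ho : ∀ x, ∃ g : Γ, g • o x = x := fun x =>
    MulAction.orbitRel_apply.1 ((MulAction.orbitRel Γ X).symm (Quotient.mk_out x))
  have hoo : ∀ (g : Γ) x, o (g • x) = o x := fun g x =>
    congrArg Quotient.out (Quotient.sound (MulAction.orbitRel_apply.2 ⟨g, rfl⟩))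
  choose k hk using ho
  choose y hy using hex
  refine ⟨fun x => k x • y (o x), fun g x => ?_, fun x => ?_⟩
  -- Freeness makes the element carrying the orbit representative to a point unique.
  · have h1 : (g * k x)⁻¹ * k (g • x) = 1 := by
      refine hfree _ (o x) ?_
      have h2 := hk (g • x)
      rw [hoo] at h2
      rw [mul_smul, h2, inv_smul_eq_iff, mul_smul, hk]
    change k (g • x) • y (o (g • x)) = g • k x • y (o x)
    rw [hoo, ← mul_smul, inv_mul_eq_one.1 h1]
  · have := hP (k x) _ _ (hy (o x))
    rwa [hk] at this

/-- The quotient `G ⧸ ⟪N⟫`, seen as a left `A`-set, has a map to `A` which is `C`-equivariant, and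
`A`-equivariant modulo `N`. -/
theorem IsAmalgamatedProduct.exists_equivariant_map {G : Type*} [Group G] {A B C : Subgroup G}
    (hG : IsAmalgamatedProduct A B C) {N : Subgroup A} [N.Normal]
    (hNC : N.map A.subtype ⊓ C = ⊥) :
    ∃ s : G ⧸ normalCl N → A,
      (∀ c (hc : c ∈ C) q, s ((c : G ⧸ normalCl N) * q) = ⟨c, hG.le_left hc⟩ * s q) ∧
      ∀ (a : A) q, (s (((a : G) : G ⧸ normalCl N) * q))⁻¹ * a * s q ∈ N := by
  let _ : MulAction (A ⧸ N) (G ⧸ normalCl N) := MulAction.compHom _ (quotientHom N)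
  -- `s` is the composite of an `A ⧸ N`-equivariant map `r : Q → A ⧸ N` and a `C`-equivariant
  -- section `τ` of `A → A ⧸ N`; the second action is free because `N ∩ C = 1`.
  obtain ⟨r, hr, -⟩ := exists_equivariant_choice (Γ := A ⧸ N) (X := G ⧸ normalCl N) (Y := A ⧸ N)
    (fun x q h => hG.quotientHom_injective hNC
      (((mul_eq_right (a := quotientHom N x) (b := q)).1 h).trans (map_one _).symm))
    (fun _ _ => True) (fun _ _ _ _ => trivial) (fun _ => ⟨1, trivial⟩)
  let _ : MulAction C A := MulAction.compHom _ (Subgroup.inclusion hG.le_left)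
  let _ : MulAction C (A ⧸ N) :=
    MulAction.compHom _ ((QuotientGroup.mk' N).comp (Subgroup.inclusion hG.le_left))
  obtain ⟨τ, hτ, hτ'⟩ := exists_equivariant_choice (Γ := C) (X := A ⧸ N) (Y := A)
    (fun c x h => by
      have h1 : (QuotientGroup.mk' N) (Subgroup.inclusion hG.le_left c) = 1 :=
        (mul_eq_right (b := x)).1 h
      have h2 : Subgroup.inclusion hG.le_left c ∈ N := (QuotientGroup.eq_one_iff _).1 h1
      have h3 : (c : G) ∈ N.map A.subtype ⊓ C := ⟨⟨_, h2, rfl⟩, c.2⟩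
      rw [hNC, Subgroup.mem_bot] at h3
      exact Subtype.ext h3)
    (fun x a => (QuotientGroup.mk' N) a = x)
    (fun c x a h => by
      change (QuotientGroup.mk' N) (Subgroup.inclusion hG.le_left c * a) =
        (QuotientGroup.mk' N) (Subgroup.inclusion hG.le_left c) * x
      rw [map_mul, h])
    QuotientGroup.mk_surjective
  refine ⟨fun q => τ (r q), fun c hc q => ?_, fun a q => ?_⟩
  · have h1 : r ((c : G ⧸ normalCl N) * q) = (⟨c, hc⟩ : C) • r q :=
      hr ((QuotientGroup.mk' N) (Subgroup.inclusion hG.le_left ⟨c, hc⟩)) q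
    change τ (r _) = _
    rw [h1, hτ]
    rfl
  · have h1 : r (((a : G) : G ⧸ normalCl N) * q) = (QuotientGroup.mk' N) a * r q :=
      hr ((QuotientGroup.mk' N) a) q
    refine (QuotientGroup.eq_one_iff _).1 ?_
    change (QuotientGroup.mk' N) ((τ (r _))⁻¹ * a * τ (r q)) = 1
    rw [map_mul, map_mul, map_inv, hτ', hτ', h1]
    group

/-- A section of `G → G ⧸ ⟪N⟫` that is `B`-equivariant, and `A`-equivariant up to the values of a
given map `s` which is `C`-equivariant and `A`-equivariant modulo `N`. -/
theorem IsAmalgamatedProduct.exists_section {G : Type*} [Group G] {A B C : Subgroup G}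
    (hG : IsAmalgamatedProduct A B C) {N : Subgroup A} [N.Normal]
    {s : G ⧸ normalCl N → A}
    (hsC : ∀ c (hc : c ∈ C) q, s ((c : G ⧸ normalCl N) * q) = ⟨c, hG.le_left hc⟩ * s q)
    (hsA : ∀ (a : A) q, (s (((a : G) : G ⧸ normalCl N) * q))⁻¹ * a * s q ∈ N) :
    ∃ σ : G ⧸ normalCl N → G, σ 1 = 1 ∧ (∀ q, (σ q : G ⧸ normalCl N) = q) ∧
      (∀ (b : B) q, σ (((b : G) : G ⧸ normalCl N) * q) = b * σ q) ∧
      ∀ (a : A) q, σ (((a : G) : G ⧸ normalCl N) * q) =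
        s (((a : G) : G ⧸ normalCl N) * q) * (s q : G)⁻¹ * σ q := by
  let π := QuotientGroup.mk' (normalCl N)
  obtain ⟨γ, hγ, hγA, hγB⟩ := hG.exists_cocycle (F := G) π
    (fun a q => s (π a * q) * (s q : G)⁻¹)
    (fun a a' q => by simp [mul_assoc])
    (fun b _ => b) (fun b b' q => by simp)
    (fun c hc q => by
      change ((s ((c : G ⧸ normalCl N) * q) : A) : G) * (s q : G)⁻¹ = c
      rw [hsC c hc]
      simp)
  have hγ1 := cocycle_one hγ
  have hγi := cocycle_inv hγ
  -- The elements on which both `π` and `γ` are trivial form a normal subgroup. It contains `N`,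
  -- hence `⟪N⟫`, so `γ g 1` depends only on `π g`.
  let K : Subgroup G :=
    { carrier := {k | π k = 1 ∧ ∀ q, γ k q = 1}
      one_mem' := ⟨map_one _, hγ1⟩
      mul_mem' := fun {x y} hx hy => ⟨by rw [map_mul, hx.1, hy.1, one_mul], fun q => by
        rw [hγ, hx.2, hy.2, one_mul]⟩
      inv_mem' := fun {x} hx => ⟨by rw [map_inv, hx.1, inv_one], fun q => by
        rw [hγi, hx.2, inv_one]⟩ }
  have hKn : K.Normal := ⟨fun k hk g => ⟨by rw [map_mul, map_mul, hk.1, mul_one, ← map_mul,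
      mul_inv_cancel, map_one], fun q => by
    rw [hγ, hγ, hk.2, mul_one, hk.1, one_mul, hγi, mul_inv_cancel]⟩⟩
  have hNK : normalCl N ≤ K := by
    refine Subgroup.normalClosure_le_normal ?_
    rintro _ ⟨n, hn, rfl⟩
    have h1 : π n = 1 := (QuotientGroup.eq_one_iff _).2
      (Subgroup.subset_normalClosure (Subgroup.mem_map_of_mem _ hn))
    refine ⟨h1, fun q => ?_⟩
    change γ n q = 1
    rw [hγA, h1, one_mul, mul_inv_cancel]
  let σ : G ⧸ normalCl N → G := fun q => γ q.out 1
  have hσ : ∀ g, σ (π g) = γ g 1 := by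
    intro g
    have h1 : g⁻¹ * (π g).out ∈ K :=
      hNK (QuotientGroup.eq.1 (QuotientGroup.out_eq' (π g)).symm)
    have h2 : (π g).out = g * (g⁻¹ * (π g).out) := by group
    change γ (π g).out 1 = _
    rw [h2, hγ, h1.1, h1.2, mul_one, mul_one]
  have hmk : ∀ g : G, (g : G ⧸ normalCl N) = π g := fun _ => rfl
  have hB : ∀ (b : B) q, σ (π b * q) = b * σ q := by
    intro b q
    obtain ⟨g, rfl⟩ := QuotientGroup.mk_surjective q
    rw [hmk, ← map_mul, hσ, hσ, hγ, hγB]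
  have hA : ∀ (a : A) q, σ (π a * q) = s (π a * q) * (s q : G)⁻¹ * σ q := by
    intro a q
    obtain ⟨g, rfl⟩ := QuotientGroup.mk_surjective q
    rw [hmk, ← map_mul, hσ, hσ, hγ, hγA, mul_one, map_mul]
  have h1 : σ 1 = 1 := by rw [← map_one π, hσ, hγ1]
  refine ⟨σ, h1, fun q => ?_, hB, hA⟩
  obtain ⟨g, rfl⟩ := QuotientGroup.mk_surjective q
  change π (σ (π g)) = π g
  induction g using hG.induction_left with
  | one => rw [map_one, h1, map_one]
  | left a g hg =>
    have h2 : π (((s (π a * π g))⁻¹ * a * s (π g) : A) : G) = 1 := (QuotientGroup.eq_one_iff _).2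
      (Subgroup.subset_normalClosure (Subgroup.mem_map_of_mem _ (hsA a (π g))))
    simp only [Subgroup.coe_mul, Subgroup.coe_inv, map_mul, map_inv, mul_assoc] at h2
    rw [map_mul, hA]
    simp only [map_mul, map_inv, hg]
    have h3 := inv_mul_eq_one.1 h2
    rw [h3]
    group
  | right b g hg => rw [map_mul, hB, map_mul, hg]

/-! ### The Cohen–Lyndon property. -/

/-- A family of homomorphisms from subgroups of `G` to `F`, extended to all of `G` by `1`. -/
noncomputable def extendOne {G F ι : Type*} [Group G] [Group F] (S : ι → Subgroup G)
    (f : ∀ i, S i →* F) (i : ι) (x : G) : F :=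
  open Classical in if hx : x ∈ S i then f i ⟨x, hx⟩ else 1

theorem extendOne_of_mem {G F ι : Type*} [Group G] [Group F] (S : ι → Subgroup G)
    (f : ∀ i, S i →* F) {i : ι} {x : G} (hx : x ∈ S i) : extendOne S f i x = f i ⟨x, hx⟩ :=
  dif_pos hx

theorem extendOne_mul {G F ι : Type*} [Group G] [Group F] (S : ι → Subgroup G)
    (f : ∀ i, S i →* F) {i : ι} {x y : G} (hx : x ∈ S i) (hy : y ∈ S i) :
    extendOne S f i (x * y) = extendOne S f i x * extendOne S f i y := by
  rw [extendOne_of_mem S f hx, extendOne_of_mem S f hy, extendOne_of_mem S f (mul_mem hx hy),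
    ← map_mul]
  rfl

theorem IsAmalgamatedProduct.cohenLyndonProperty {G : Type*} [Group G] {A B C : Subgroup G}
    (hG : IsAmalgamatedProduct A B C) {N : Subgroup A} [N.Normal]
    (hNC : N.map A.subtype ⊓ C = ⊥) : CohenLyndonProperty A N := by
  obtain ⟨s, hsC, hsA⟩ := hG.exists_equivariant_map hNC
  obtain ⟨σ, hσ1, hσ, hσB, hσA⟩ := hG.exists_section hsC hsA
  let π := QuotientGroup.mk' (normalCl N)
  change ∀ q, π (σ q) = q at hσ
  change ∀ (b : B) q, σ (π b * q) = b * σ q at hσB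
  change ∀ (a : A) q, σ (π a * q) = s (π a * q) * (s q : G)⁻¹ * σ q at hσA
  change ∀ (a : A) q, (s (π a * q))⁻¹ * a * s q ∈ N at hsA
  have hπN : ∀ n ∈ N, π (n : G) = 1 := fun n hn => (QuotientGroup.eq_one_iff _).2
    (Subgroup.subset_normalClosure (Subgroup.mem_map_of_mem _ hn))
  -- `u q` lies over `q⁻¹ * π (s q)`, so it represents the coset of `A⟪N⟫` given by the inverse of
  -- the `A`-orbit of `q`.
  let u : G ⧸ normalCl N → G := fun q => (σ q)⁻¹ * s q
  have huA : ∀ (a : A) q, u (π a * q) = u q := by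
    intro a q
    change (σ (π a * q))⁻¹ * _ = (σ q)⁻¹ * _
    rw [hσA]
    group
  let T : Set G := Set.range u
  let t : G ⧸ normalCl N → T := fun q => ⟨u q, q, rfl⟩
  let S : T → Subgroup G := fun t => (N.map A.subtype).map (MulAut.conj (t : G)).toMonoidHom
  have hS : ∀ q (n : A), n ∈ N → u q * n * (u q)⁻¹ ∈ S (t q) := fun q n hn =>
    ⟨n, ⟨n, hn, rfl⟩, rfl⟩
  have hSA : ∀ (a : A) q, (σ (π a * q))⁻¹ * a * σ q ∈ S (t q) := by
    intro a q
    have h1 := hS q _ (hsA a q)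
    have h2 : (σ (π a * q))⁻¹ * a * σ q =
        u q * ((s (π a * q))⁻¹ * a * s q : A) * (u q)⁻¹ := by
      rw [hσA]
      simp only [u, Subgroup.coe_mul, Subgroup.coe_inv]
      group
    rwa [h2]
  have htA : ∀ (a : A) q, t (π a * q) = t q := fun a q => Subtype.ext (huA a q)
  -- Extending by `1` avoids transport between the factors at `t (π a * q)` and `t q`, whose indices
  -- are only propositionally equal.
  let E := extendOne S fun i => Monoid.CoprodI.of (M := fun i => S i) (i := i)
  obtain ⟨γ, hγ, hγA, hγB⟩ := hG.exists_cocycle (F := Monoid.CoprodI fun i => S i) π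
    (fun a q => E (t q) ((σ (π a * q))⁻¹ * a * σ q))
    (fun a a' q => by
      have h1 := hSA a (π a' * q)
      rw [htA] at h1
      simp only [htA]
      rw [← extendOne_mul _ _ h1 (hSA a' q)]
      congr 1
      simp only [Subgroup.coe_mul, map_mul]
      group)
    (fun _ _ => 1) (fun b b' q => (one_mul _).symm)
    (fun c hc q => by
      -- The prescription on `A` is trivial on `C` because `σ` is `B`-equivariant.
      have h1 : σ (π c * q) = c * σ q := hσB ⟨c, hG.le_right hc⟩ q
      have h2 : (σ (π c * q))⁻¹ * c * σ q = 1 := by rw [h1]; group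
      change E (t q) ((σ (π c * q))⁻¹ * c * σ q) = 1
      rw [h2]
      exact (extendOne_of_mem _ _ (one_mem _)).trans (map_one _))
  have hγ1 := cocycle_one hγ
  have hγi := cocycle_inv hγ
  let L := Monoid.CoprodI.lift fun i => (S i).subtype
  have hL : ∀ g q, L (γ g q) = (σ (π g * q))⁻¹ * g * σ q := by
    intro g
    induction g using hG.induction_left with
    | one => intro q; rw [hγ1, map_one, map_one, one_mul]; group
    | left a g hg =>
      intro q
      rw [hγ, map_mul, hg, hγA]
      rw [show E _ _ = _ from extendOne_of_mem _ _ (hSA a (π g * q)), Monoid.CoprodI.lift_of]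
      simp only [Subgroup.subtype_apply, map_mul, mul_assoc]
      group
    | right b g hg =>
      intro q
      rw [hγ, map_mul, hg, hγB, map_one, one_mul, map_mul, mul_assoc (π (b : G)), hσB]
      group
  -- `σ q` is built up by left multiplications by elements of `B` and by `s (a q) * (s q)⁻¹`; on
  -- each of these the cocycle is trivial at the relevant point.
  have hγσ : ∀ q, γ (σ q) 1 = 1 := by
    intro q
    obtain ⟨g, rfl⟩ := QuotientGroup.mk_surjective q
    change γ (σ (π g)) 1 = 1
    induction g using hG.induction_left with
    | one => rw [map_one, hσ1, hγ1]
    | left a g hg =>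
      let a' : A := s (π a * π g) * (s (π g))⁻¹
      have h1 : σ (π a * π g) = a' * σ (π g) := hσA a (π g)
      have h2 : π a' * π g = π a * π g := by
        rw [← hσ (π a * π g), h1, map_mul, hσ]
      rw [map_mul, h1, hγ, hg, mul_one, mul_one, hσ, hγA, h2, h1]
      have h3 : ((a' : G) * σ (π g))⁻¹ * a' * σ (π g) = 1 := by group
      rw [h3]
      exact (extendOne_of_mem _ _ (one_mem _)).trans (map_one _)
    | right b g hg => rw [map_mul, hσB, hγ, hγB, hg, mul_one]
  have hSK : ∀ i, S i ≤ normalCl N := by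
    rintro i _ ⟨_, hn, rfl⟩
    exact Subgroup.normalClosure_normal.conj_mem _ (Subgroup.subset_normalClosure hn) _
  have hLK : ∀ x, π (L x) = 1 := fun x => (QuotientGroup.eq_one_iff _).2
    (Monoid.CoprodI.lift_range_le (s := normalCl N) _ _
      (fun i => by rw [Subgroup.range_subtype]; exact hSK i) ⟨x, rfl⟩)
  refine ⟨T, ?_, ?_, ?_⟩
  · have hsup : ∀ x, x ∈ A ⊔ normalCl N → ∃ a : A, π x = π a := by
      intro x hx
      obtain ⟨a, ha, k, hk, rfl⟩ := Subgroup.mem_sup_of_normal_right.1 hx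
      exact ⟨⟨a, ha⟩, by rw [map_mul, show π k = 1 from (QuotientGroup.eq_one_iff k).2 hk, mul_one]⟩
    rw [Subgroup.isComplement_iff_existsUnique_inv_mul_mem]
    intro g
    refine ⟨t (π g⁻¹), ?_, ?_⟩
    · have h1 : σ (π g⁻¹) * g ∈ normalCl N := (QuotientGroup.eq_one_iff _).1 (by
        change π _ = 1
        rw [map_mul, hσ, map_inv, inv_mul_cancel])
      have h2 : (u (π g⁻¹))⁻¹ * g = ((s (π g⁻¹))⁻¹ : A) * (σ (π g⁻¹) * g) := by
        simp only [u, Subgroup.coe_inv]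
        group
      change (u (π g⁻¹))⁻¹ * g ∈ A ⊔ normalCl N
      rw [h2]
      exact mul_mem (Subgroup.mem_sup_left (Subtype.prop _)) (Subgroup.mem_sup_right h1)
    · rintro ⟨_, q, rfl⟩ hq
      obtain ⟨a, ha⟩ := hsup _ hq
      refine Subtype.ext ?_
      change u q = u _
      have h1 : π g⁻¹ = π ((s q * a)⁻¹ : A) * q := by
        have h2 : π ((s q : G)⁻¹ * σ q * g) = π a := by
          rw [← ha]
          congr 1
          simp only [u]
          group
        rw [map_mul, map_mul, hσ, map_inv] at h2
        simp only [Subgroup.coe_mul, Subgroup.coe_inv, map_mul, map_inv, ← h2]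
        group
      rw [h1, huA]
  · have hmul : ∀ x y, γ (L (x * y)) 1 = γ (L x) 1 * γ (L y) 1 := by
      intro x y
      rw [map_mul, hγ, hLK, one_mul]
    have key : ∀ x, γ (L x) 1 = x := by
      intro x
      induction x using Monoid.CoprodI.induction_on with
      | one => rw [map_one, hγ1]
      | mul x y hx hy => rw [hmul, hx, hy]
      | of i x =>
        obtain ⟨x, hx⟩ := x
        obtain ⟨_, q, rfl⟩ := i
        obtain ⟨_, ⟨n, hn, rfl⟩, hnx⟩ := hx
        -- Conjugating by `s q` turns the generator at `u q` into `(σ q)⁻¹ * n' * σ q`; the outer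
        -- factors contribute nothing to the cocycle, by `hγσ`.
        let n' : A := s q * n * (s q)⁻¹
        have hn' : n' ∈ N := Subgroup.Normal.conj_mem inferInstance n hn (s q)
        have hx' : x = (σ q)⁻¹ * (n' * σ q) := by
          rw [← hnx]
          change (σ q)⁻¹ * s q * n * ((σ q)⁻¹ * s q)⁻¹ = _
          simp only [n', Subgroup.coe_mul, Subgroup.coe_inv]
          group
        rw [Monoid.CoprodI.lift_of]
        change γ x 1 = _
        have h1 : π n' = 1 := hπN n' hn'
        have h2 : γ x 1 = E (t q) x := by
          have h3 : π (σ q)⁻¹ * q = 1 := by rw [map_inv, hσ, inv_mul_cancel]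
          conv_lhs => rw [hx']
          rw [hγ, map_mul, h1, mul_one, one_mul, hσ, hγi, h3, hγσ, hγ, hγσ, mul_one, mul_one, hσ,
            inv_one, one_mul, hγA, h1, one_mul, hx', mul_assoc]
        rw [h2]
        exact extendOne_of_mem _ _ _
    exact Function.LeftInverse.injective (g := fun x => γ x 1) key
  -- For `k ∈ ⟪N⟫`, `hL` at `q = 1` reads `L (γ k 1) = k`, as `σ 1 = 1`.
  · refine le_antisymm ?_ fun k hk => ⟨γ k 1, ?_⟩
    · exact Monoid.CoprodI.lift_range_le _ _ fun i => by
        rw [Subgroup.range_subtype]; exact hSK i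
    · have h1 : π k = 1 := (QuotientGroup.eq_one_iff _).2 hk
      change L _ = k
      rw [hL, h1, one_mul, hσ1]
      group

/-! ### Relation modules and induced modules. -/

/-- The class in `Rel(H, N)` of an element of `N`. -/
def relClass {H : Type*} [Group H] (N : Subgroup H) [N.Normal] :
    N →* Multiplicative (RelModule N) :=
  Abelianization.of (G := N)

theorem relClass_surjective {H : Type*} [Group H] (N : Subgroup H) [N.Normal] (x : RelModule N) :
    ∃ n, (relClass N n).toAdd = x :=
  QuotientGroup.mk_surjective x

theorem of_smul_relClass {H : Type*} [Group H] (N : Subgroup H) [N.Normal] (h : H) (n : N) :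
    MonoidAlgebra.of ℤ (H ⧸ N) h • (relClass N n).toAdd =
      (relClass N (MulAut.conjNormal h n)).toAdd := by
  refine (Representation.single_smul (ρ := relRep N) _ _ _).trans ?_
  rw [one_smul]
  rfl

/-- A homomorphism from `N` to a commutative group, as a map on `Rel(H, N)`. -/
def relLift {H X : Type*} [Group H] [AddCommGroup X] (N : Subgroup H) [N.Normal]
    (f : N →* Multiplicative X) : RelModule N →+ X :=
  MonoidHom.toAdditiveLeft (Abelianization.lift f)

theorem relLift_relClass {H X : Type*} [Group H] [AddCommGroup X] (N : Subgroup H) [N.Normal]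
    (f : N →* Multiplicative X) (n : N) :
    relLift N f (relClass N n).toAdd = (f n).toAdd :=
  rfl

/-- The element `x ⊗ m` of an induced module. -/
def inducedTmul {D O M : Type*} [Ring D] [Ring O] (f : D →+* O) [AddCommGroup M] [Module D M]
    (x : O) : M →+ InducedModule f M :=
  (balancedRelations f M).mkQ.toAddMonoidHom.comp (TensorProduct.mk ℤ O M x).toAddMonoidHom

theorem inducedTmul_mul {D O M : Type*} [Ring D] [Ring O] (f : D →+* O) [AddCommGroup M]
    [Module D M] (x : O) (d : D) (m : M) :
    inducedTmul f (x * f d) m = inducedTmul f x (d • m) :=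
  (Submodule.Quotient.eq _).2 (Submodule.subset_span ⟨x, d, m, rfl⟩)

theorem inducedTmul_add {D O M : Type*} [Ring D] [Ring O] (f : D →+* O) [AddCommGroup M]
    [Module D M] (x y : O) (m : M) :
    inducedTmul f (x + y) m = inducedTmul f x m + inducedTmul f y m :=
  congrArg (balancedRelations f M).mkQ (TensorProduct.add_tmul x y m)

theorem inducedTmul_zsmul {D O M : Type*} [Ring D] [Ring O] (f : D →+* O) [AddCommGroup M]
    [Module D M] (z : ℤ) (x : O) (m : M) :
    inducedTmul f (z • x) m = inducedTmul f x (z • m) :=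
  congrArg (balancedRelations f M).mkQ (TensorProduct.smul_tmul z x m)

theorem inducedModule_induction {D O M : Type*} [Ring D] [Ring O] (f : D →+* O) [AddCommGroup M]
    [Module D M] {P : InducedModule f M → Prop} (tmul : ∀ x m, P (inducedTmul f x m))
    (add : ∀ y z, P y → P z → P (y + z)) (y : InducedModule f M) : P y := by
  obtain ⟨y, rfl⟩ := (balancedRelations f M).mkQ_surjective y
  induction y using TensorProduct.induction_on with
  | zero => simpa using tmul 0 0
  | tmul x m => exact tmul x m
  | add y z hy hz => rw [map_add]; exact add _ _ hy hz

/-- The universal property of induced modules. -/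
theorem exists_inducedLift {D O M P : Type*} [Ring D] [Ring O] (f : D →+* O) [AddCommGroup M]
    [Module D M] [AddCommGroup P] [Module O P] (g : M →+ P) (hg : ∀ d m, g (d • m) = f d • g m) :
    ∃ Ψ : InducedModule f M →ₗ[O] P, ∀ x m, Ψ (inducedTmul f x m) = x • g m := by
  let Ψ₀ : O ⊗[ℤ] M →ₗ[O] P := TensorProduct.AlgebraTensorModule.lift
    (LinearMap.toSpanSingleton O (M →ₗ[ℤ] P) g.toIntLinearMap)
  have hΨ₀ : ∀ x m, Ψ₀ (x ⊗ₜ m) = x • g m := fun _ _ => rfl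
  refine ⟨(balancedRelations f M).liftQ Ψ₀ ?_, fun x m => hΨ₀ x m⟩
  refine Submodule.span_le.2 ?_
  rintro _ ⟨x, d, m, rfl⟩
  change Ψ₀ _ = 0
  rw [map_sub, hΨ₀, hΨ₀, hg, mul_smul, sub_self]

/-- The inclusion of `N` in its normal closure. -/
def toNormalCl {G : Type*} [Group G] {H : Subgroup G} (N : Subgroup H) : N →* normalCl N :=
  (H.subtype.comp N.subtype).codRestrict (normalCl N) fun n =>
    Subgroup.subset_normalClosure (Subgroup.mem_map_of_mem _ n.2)

theorem groupRingHom_of {G : Type*} [Group G] {H : Subgroup G} (N : Subgroup H) [N.Normal]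
    (x : H ⧸ N) : groupRingHom N (MonoidAlgebra.of ℤ _ x) =
      MonoidAlgebra.of ℤ _ (quotientHom N x) :=
  MonoidAlgebra.mapDomain_single

/-- The `ℤQ`-linear map from the module induced by `Rel(H, N)` to `Rel(G, ⟪N⟫)`. -/
theorem exists_inducedModule_relModule {G : Type*} [Group G] {H : Subgroup G} (N : Subgroup H)
    [N.Normal] :
    ∃ Ψ : InducedModule (groupRingHom N) (RelModule N)
        →ₗ[MonoidAlgebra ℤ (G ⧸ normalCl N)] RelModule (normalCl N),
      ∀ (g : G) (n : N), Ψ (inducedTmul (groupRingHom N)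
        (MonoidAlgebra.of ℤ _ (g : G ⧸ normalCl N)) (relClass N n).toAdd) =
          (relClass (normalCl N) (MulAut.conjNormal g (toNormalCl N n))).toAdd := by
  let Ψ₀ : RelModule N →+ RelModule (normalCl N) :=
    relLift N ((relClass (normalCl N)).comp (toNormalCl N))
  have hΨ₀ : ∀ n, Ψ₀ (relClass N n).toAdd = (relClass (normalCl N) (toNormalCl N n)).toAdd :=
    relLift_relClass N _
  obtain ⟨Ψ, hΨ⟩ := exists_inducedLift (groupRingHom N) Ψ₀ (by
    intro d m
    induction d using MonoidAlgebra.induction_on with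
    | of x =>
      obtain ⟨h, rfl⟩ := QuotientGroup.mk_surjective x
      obtain ⟨n, rfl⟩ := relClass_surjective N m
      rw [of_smul_relClass, groupRingHom_of, hΨ₀, hΨ₀]
      exact (of_smul_relClass (normalCl N) (h : G) (toNormalCl N n)).symm
    | add x y hx hy => rw [add_smul, map_add, hx, hy, map_add, add_smul]
    | smul z x hx => rw [smul_assoc, map_zsmul, hx, map_zsmul, smul_assoc])
  refine ⟨Ψ, fun g n => ?_⟩
  rw [hΨ, hΨ₀, of_smul_relClass]

/-- The Cohen–Lyndon property determines the relative relation module of the normal closure. -/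
theorem CohenLyndonProperty.nonempty_relModule_equiv {G : Type*} [Group G] {H : Subgroup G}
    {N : Subgroup H} [N.Normal] (h : CohenLyndonProperty H N) :
    Nonempty (RelModule (normalCl N) ≃ₗ[MonoidAlgebra ℤ (G ⧸ normalCl N)]
      InducedModule (groupRingHom N) (RelModule N)) := by
  obtain ⟨T, hT, hinj, hrange⟩ := h
  let S : T → Subgroup G := fun t => (N.map H.subtype).map (MulAut.conj (t : G)).toMonoidHom
  let L : (Monoid.CoprodI fun t => S t) →* G := Monoid.CoprodI.lift fun t => (S t).subtype
  change Function.Injective L at hinj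
  change L.range = _ at hrange
  let L' : (Monoid.CoprodI fun t => S t) →* normalCl N :=
    L.codRestrict (normalCl N) fun x => hrange.le ⟨x, rfl⟩
  have hL' : Function.Bijective L' := by
    refine ⟨fun x y hxy => hinj (congrArg Subtype.val hxy), fun k => ?_⟩
    obtain ⟨x, hx⟩ : (k : G) ∈ L.range := hrange.ge k.2
    exact ⟨x, Subtype.ext hx⟩
  let e := MulEquiv.ofBijective L' hL'
  let j : ∀ t : T, N ≃* S t := fun t =>
    (N.equivMapOfInjective H.subtype H.subtype_injective).trans
      ((N.map H.subtype).equivMapOfInjective (MulAut.conj (t : G)).toMonoidHom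
        (MulAut.conj (t : G)).injective)
  have hj : ∀ t n, L' (Monoid.CoprodI.of (j t n)) =
      MulAut.conjNormal (t : G) (toNormalCl N n) := fun t n =>
    Subtype.ext (Monoid.CoprodI.lift_of (M := fun t => S t) (fun t => (S t).subtype) (j t n))
  obtain ⟨Ψ, hΨ⟩ := exists_inducedModule_relModule N
  let τ : T → RelModule N →+ InducedModule (groupRingHom N) (RelModule N) := fun t =>
    inducedTmul (groupRingHom N) (MonoidAlgebra.of ℤ _ ((t : G) : G ⧸ normalCl N))
  let θ : (Monoid.CoprodI fun t => S t) →*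
      Multiplicative (InducedModule (groupRingHom N) (RelModule N)) :=
    Monoid.CoprodI.lift fun t =>
      ((AddMonoidHom.toMultiplicative (τ t)).comp (relClass N)).comp (j t).symm.toMonoidHom
  -- The free product decomposition gives `Θ` only as an additive map; this suffices, since
  -- linearity is already carried by `Ψ`.
  let Θ : RelModule (normalCl N) →+ InducedModule (groupRingHom N) (RelModule N) :=
    relLift (normalCl N) (θ.comp e.symm.toMonoidHom)
  have hΘ : ∀ (t : T) n, Θ (relClass (normalCl N)
      (MulAut.conjNormal (t : G) (toNormalCl N n))).toAdd = τ t (relClass N n).toAdd := by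
    intro t n
    rw [← hj]
    refine (relLift_relClass _ _ _).trans ?_
    change (θ (e.symm (e _))).toAdd = _
    rw [MulEquiv.symm_apply_apply]
    refine (congrArg Multiplicative.toAdd (Monoid.CoprodI.lift_of (M := fun t => S t) _ _)).trans ?_
    change τ t (relClass N ((j t).symm (j t n))).toAdd = _
    rw [MulEquiv.symm_apply_apply]
  have hleft : ∀ y, Θ (Ψ y) = y := by
    intro y
    induction y using inducedModule_induction with
    | add y z hy hz => rw [map_add, map_add, hy, hz]
    | tmul x m =>
      induction x using MonoidAlgebra.induction_on generalizing m with
      | add x y hx hy => rw [inducedTmul_add, map_add, map_add, hx, hy]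
      | smul z x hx => rw [inducedTmul_zsmul, hx]
      | of q =>
        obtain ⟨g, rfl⟩ := QuotientGroup.mk_surjective q
        obtain ⟨⟨t, y⟩, hty, -⟩ := hT.existsUnique g
        obtain ⟨a, ha, k, hk, hak⟩ := Subgroup.mem_sup_of_normal_right.1 y.2
        -- Each element of `Q` is a transversal element times one of `R`; the latter moves across
        -- the tensor, leaving the generators where `Θ` is known.
        have hq : (g : G ⧸ normalCl N) =
            ((t : G) : G ⧸ normalCl N) * quotientHom N ((⟨a, ha⟩ : H) : H ⧸ N) := by
          rw [← hty, ← hak]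
          change ((t * (a * k) : G) : G ⧸ normalCl N) = ((t * a : G) : G ⧸ normalCl N)
          rw [QuotientGroup.eq]
          have : (t * (a * k) : G)⁻¹ * (t * a) = k⁻¹ := by group
          rw [this]
          exact inv_mem hk
        rw [hq, map_mul, ← groupRingHom_of, inducedTmul_mul]
        obtain ⟨n, hn⟩ := relClass_surjective N
          (MonoidAlgebra.of ℤ _ ((⟨a, ha⟩ : H) : H ⧸ N) • m)
        rw [← hn, hΨ, hΘ]
  have hsurj : Function.Surjective Ψ := by
    intro x
    obtain ⟨k, rfl⟩ := relClass_surjective _ x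
    obtain ⟨w, rfl⟩ := hL'.2 k
    induction w using Monoid.CoprodI.induction_on with
    | one => exact ⟨0, by rw [map_zero, map_one, map_one]; rfl⟩
    | mul v w hv hw =>
      obtain ⟨y, hy⟩ := hv
      obtain ⟨z, hz⟩ := hw
      exact ⟨y + z, by rw [map_add, hy, hz, map_mul, map_mul]; rfl⟩
    | of t x =>
      obtain ⟨n, rfl⟩ := (j t).surjective x
      exact ⟨_, (hΨ t n).trans (by rw [hj])⟩
  exact ⟨(LinearEquiv.ofBijective Ψ ⟨Function.LeftInverse.injective hleft, hsurj⟩).symm⟩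

theorem mainTheorem6 {G : Type*} [Group G] (A B C : Subgroup G)
    (hG : IsAmalgamatedProduct A B C) (N : Subgroup A) [N.Normal]
    (hNC : N.map A.subtype ⊓ C = ⊥) :
    CohenLyndonProperty A N ∧
    Function.Injective (quotientHom N) ∧
    Nonempty (RelModule (normalCl N) ≃ₗ[MonoidAlgebra ℤ (G ⧸ normalCl N)]
      InducedModule (groupRingHom N) (RelModule N)) :=
  ⟨hG.cohenLyndonProperty hNC, hG.quotientHom_injective hNC,
    (hG.cohenLyndonProperty hNC).nonempty_relModule_equiv⟩
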